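/- Let $I$ and $A$ be finite sets with $A\neq\emptyset$, and let $(\alpha_i)_{i\in I}$ be the standard basis of $\mathbb Z^I$. Let $\mathcal C=\mathcal C(I,A,(\rho_i)_{i\in I},(C^a)_{a\in A})$ be a Cartan scheme: for $i\in I$ a map $\rho_i:A\to A$ with $\rho_i^2=\mathrm{id}$, and for $a\in A$ a generalized Cartan matrix $C^a=(c^a_{jk})_{j,k\in I}\in\mathbb Z^{I\times I}$ (that is, $c^a_{jj}=2$, $c^a_{jk}\le 0$ for $j\ne k$, and $c^a_{jk}=0$ implies $c^a_{kj}=0$), such that $c^a_{ij}=c^{\rho_i(a)}_{ij}$ for all $a\in A$ and $i,j\in I$. Let $s_i^a\in\mathrm{Aut}(\mathbb Z^I)$ be given by $s_i^a(\alpha_j)=\alpha_j-c^a_{ij}\alpha_i$; it is regarded as a morphism from $a$ to $\rho_i(a)$. For $a\in A$ let $$(R^{\mathrm{re}})^a=\{\mathrm{id}^a s_{i_1}\cdots s_{i_k}(\alpha_j)\mid k\ge 0,\ i_1,\dots,i_k,j\in I\}\subseteq\mathbb Z^I$$ be the set of real roots at $a$, where $\mathrm{id}^a s_{i_1}\cdots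 s_{i_k}$ denotes the composition $s_{i_1}^{a_1}s_{i_2}^{a_2}\cdots s_{i_k}^{a_k}$ with $a_0=a$ and $a_r=\rho_{i_r}(a_{r-1})$; a real root is positive if it lies in $\mathbb N_0^I$. Assume that all the sets $R^a:=(R^{\mathrm{re}})^a$ are finite and that they form a root system of type $\mathcal C$, that is, for all $a\in A$ and $i,j\in I$: (R1) $R^a=R^a_+\cup -R^a_+$, where $R^a_+=R^a\cap\mathbb N_0^I$; (R2) $R^a\cap\mathbb Z\alpha_i=\{\alpha_i,-\alpha_i\}$; (R3) $s_i^a(R^a)=R^{\rho_i(a)}$; (R4) if $i\ne j$ and $m^a_{i,j}=|R^a\cap(\mathbb N_0\alpha_i+\mathbb N_0\alpha_j)|$ is finite, then $(\rho_i\rho_j)^{m^a_{i,j}}(a)=a$. Let $a\in A$ and let $(\cdot,\cdot)$ be any scalar product (symmetric positive definite bilinear form) on $\mathbb R^I$. Then the set of hyperplanes $$\mathcal A^a_{\mathcal C}=\{H_\alpha\mid \alpha\in (R^{\mathrm{re}})^a_+\},\qquad H_\alpha=\{\lambda\in\mathbb R^I\mid(\lambda,\alpha)=0\},$$ is a simplicial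 arrangement: it is a finite set of linear hyperplanes in $\mathbb R^I$, and every connected component of $\mathbb R^I\setminus\bigcup_{H\in\mathcal A^a_{\mathcal C}}H$ is an open simplicial cone, i.e. the set of all linear combinations with positive coefficients of the elements of some basis of $\mathbb R^I$. -/

import Mathlib

/-- Generalized Cartan matrices: integer matrices with `2` on the diagonal, non-positive entries off
the diagonal, and a symmetric zero pattern. -/
structure IsGeneralizedCartanMatrix {I : Type*} (M : Matrix I I ℤ) : Prop where
  diag : ∀ i, M i i = 2
  off_diag_nonpos : ∀ i j, i ≠ j → M i j ≤ 0
  zero_symm : ∀ i j, M i j = 0 → M j i = 0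

/-- A Cartan scheme with index set `I` and set of objects `A`: maps `ρ i : A → A` and a generalized
Cartan matrix `cartan a` for every object `a`. -/
structure CartanScheme (I A : Type*) where
  ρ : I → A → A
  cartan : A → Matrix I I ℤ
  isGCM : ∀ a, IsGeneralizedCartanMatrix (cartan a)
  /-- Axiom (C1). -/
  ρ_ρ : ∀ i a, ρ i (ρ i a) = a
  /-- Axiom (C2). -/
  cartan_ρ : ∀ a i j, cartan a i j = cartan (ρ i a) i j

/-- The standard basis vector `α i` of `ℤ^I`. -/
def simpleRoot {I : Type*} [DecidableEq I] (i : I) : I → ℤ := Pi.single i 1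

namespace CartanScheme

variable {I A : Type*} [Fintype I] [DecidableEq I] (C : CartanScheme I A)

/-- The linear form `x ↦ ∑ j, c^a_{ij} x_j` on `ℤ^I`. -/
def coform (i : I) (a : A) : Module.Dual ℤ (I → ℤ) :=
  ∑ j, C.cartan a i j • LinearMap.proj j

lemma coform_simpleRoot (i j : I) (a : A) :
    C.coform i a (simpleRoot j) = C.cartan a i j := by
  simp [coform, simpleRoot, LinearMap.sum_apply, Pi.single_apply]

/-- The reflection `s_i^a`, an automorphism of `ℤ^I`, which in the Weyl groupoid is a morphism
from `a` to `ρ i a`. -/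
def s (i : I) (a : A) : (I → ℤ) ≃ₗ[ℤ] (I → ℤ) :=
  Module.reflection (x := simpleRoot i) (f := C.coform i a)
    ((C.coform_simpleRoot i i a).trans ((C.isGCM a).diag i))

/-- The defining formula of the reflections on the standard basis. -/
lemma s_simpleRoot (i j : I) (a : A) :
    C.s i a (simpleRoot j) = simpleRoot j - C.cartan a i j • simpleRoot i := by
  rw [s, Module.reflection_apply, coform_simpleRoot]

/-- The morphism `id^a s_{i₁} ⋯ s_{iₖ}` of the Weyl groupoid with target `a`, as a linear
automorphism of `ℤ^I`. Its first letter is the morphism `s_{i₁}` from `ρ i₁ a` to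
`ρ i₁ (ρ i₁ a) = a`, and the remaining word has target `ρ i₁ a`. -/
def word : A → List I → (I → ℤ) ≃ₗ[ℤ] (I → ℤ)
  | _, [] => LinearEquiv.refl ℤ (I → ℤ)
  | a, i :: l => (word (C.ρ i a) l).trans (C.s i (C.ρ i a))

/-- The set of real roots at `a`. -/
def realRoots (a : A) : Set (I → ℤ) :=
  {β | ∃ (l : List I) (j : I), β = C.word a l (simpleRoot j)}

/-- The family `R` of subsets of `ℤ^I` is a root system of type `C`. -/
structure IsRootSystem (R : A → Set (I → ℤ)) : Prop where
  /-- Axiom (R1). -/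
  pos_or_neg : ∀ a, R a = {β ∈ R a | 0 ≤ β} ∪ {β | -β ∈ {γ ∈ R a | 0 ≤ γ}}
  /-- Axiom (R2). -/
  inter_multiples : ∀ a i, R a ∩ {β | ∃ n : ℤ, β = n • simpleRoot i}
    = {simpleRoot i, -simpleRoot i}
  /-- Axiom (R3). -/
  image_s : ∀ a i, C.s i a '' R a = R (C.ρ i a)
  /-- Axiom (R4): here `m_{i,j}^a` is the number of elements of the set `R^a ∩ (ℕ α_i + ℕ α_j)`. -/
  iterate_ρ : ∀ a i j, i ≠ j →
    (R a ∩ {β | ∃ m n : ℕ, β = m • simpleRoot i + n • simpleRoot j}).Finite →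
    (C.ρ i ∘ C.ρ j)^[(R a ∩ {β | ∃ m n : ℕ, β = m • simpleRoot i + n • simpleRoot j}).ncard] a = a

/-- The hyperplane `H_β = {v ∈ ℝ^I | (v, β) = 0}`. -/
def rootHyperplane (B : LinearMap.BilinForm ℝ (I → ℝ)) (β : I → ℤ) : Submodule ℝ (I → ℝ) :=
  LinearMap.ker (B.flip (fun i => (β i : ℝ)))

/-- The set of the hyperplanes `H_β` for the positive real roots `β` at `a`. -/
def arrangement (a : A) (B : LinearMap.BilinForm ℝ (I → ℝ)) : Set (Submodule ℝ (I → ℝ)) :=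
  {H | ∃ β ∈ C.realRoots a, 0 ≤ β ∧ H = rootHyperplane B β}

end CartanScheme

/-- A scalar product on a real vector space: a symmetric positive definite bilinear form. -/
structure IsScalarProduct {V : Type*} [AddCommGroup V] [Module ℝ V]
    (B : LinearMap.BilinForm ℝ V) : Prop where
  symm : ∀ x y, B x y = B y x
  pos : ∀ x, x ≠ 0 → 0 < B x x

/-- An open simplicial cone of `V`: the set of linear combinations with positive coefficients of
some basis of `V`. -/
def IsOpenSimplicialCone {V : Type*} [AddCommGroup V] [Module ℝ V] (K : Set V) : Prop :=
  ∃ b : Module.Basis (Fin (Module.finrank ℝ V)) ℝ V,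
    K = {v | ∃ c : Fin (Module.finrank ℝ V) → ℝ, (∀ i, 0 < c i) ∧ v = ∑ i, c i • b i}

/-- A simplicial arrangement: a finite set of linear hyperplanes (maximal proper subspaces) such
that every connected component of the complement of their union is an open simplicial cone. -/
structure IsSimplicialArrangement {V : Type*} [AddCommGroup V] [Module ℝ V] [TopologicalSpace V]
    (𝓐 : Set (Submodule ℝ V)) : Prop where
  finite : 𝓐.Finite
  isHyperplane : ∀ H ∈ 𝓐, IsCoatom H
  component : ∀ x ∈ (⋃ H ∈ 𝓐, (H : Set V))ᶜ,
    IsOpenSimplicialCone (connectedComponentIn (⋃ H ∈ 𝓐, (H : Set V))ᶜ x)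

/-! A vector `v` is treated as the functional `(v, ·)` on roots; the complement of the arrangement
consists of those vanishing at no real root. If such a functional is negative at a simple root,
pulling it back along that reflection lowers the number of positive roots where it is negative;
hence it is positive on the images `w(α_j)` for some word `w` (`exists_word_pos`). Conversely, every
root is a combination of the `w(α_j)` with coefficients of one sign, so positivity on them excludes
zeros (`ne_zero_of_word_pos`). Each component is therefore a cone `{v | (v, w(α_j)) > 0 for all j}`,
spanned by the dual basis of the `w(α_j)`. -/

lemma simpleRoot_nonneg {I : Type*} [DecidableEq I] (i : I) : 0 ≤ simpleRoot i := by
  intro j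
  by_cases h : j = i <;> simp [simpleRoot, h]

lemma simpleRoot_ne_zero {I : Type*} [DecidableEq I] (i : I) : simpleRoot i ≠ 0 := by
  simp [simpleRoot]

lemma sum_smul_simpleRoot {I : Type*} [Fintype I] [DecidableEq I] (β : I → ℤ) :
    ∑ j, β j • simpleRoot j = β := by
  ext k
  simp [simpleRoot, Pi.single_apply, Finset.sum_apply]

/-- A functional which is negative on a vector with nonnegative coordinates is negative on some
simple root. -/
lemma exists_simpleRoot_neg {I : Type*} [Fintype I] [DecidableEq I] (x : (I → ℤ) →+ ℝ)
    {β : I → ℤ} (hβ : 0 ≤ β) (hx : x β < 0) : ∃ i, x (simpleRoot i) < 0 := by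
  by_contra! h
  apply hx.not_ge
  rw [← sum_smul_simpleRoot β, map_sum]
  refine Finset.sum_nonneg fun j _ => ?_
  rw [map_zsmul]
  exact zsmul_nonneg (h j) (hβ j)

namespace CartanScheme

variable {I A : Type*} [Fintype I] [DecidableEq I] {C : CartanScheme I A}

lemma simpleRoot_mem_realRoots (C : CartanScheme I A) (a : A) (j : I) :
    simpleRoot j ∈ C.realRoots a :=
  ⟨[], j, rfl⟩

lemma word_simpleRoot_mem_realRoots (C : CartanScheme I A) (a : A) (l : List I) (j : I) :
    C.word a l (simpleRoot j) ∈ C.realRoots a :=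
  ⟨l, j, rfl⟩

lemma ne_zero_of_mem_realRoots {a : A} {β : I → ℤ} (hβ : β ∈ C.realRoots a) : β ≠ 0 := by
  obtain ⟨l, j, rfl⟩ := hβ
  simpa using simpleRoot_ne_zero j

lemma s_apply_of_ne (C : CartanScheme I A) (a : A) {i j : I} (h : j ≠ i) (β : I → ℤ) :
    C.s i a β j = β j := by
  simp [s, Module.reflection_apply, simpleRoot, h]

lemma s_simpleRoot_self (C : CartanScheme I A) (a : A) (i : I) :
    C.s i a (simpleRoot i) = -simpleRoot i := by
  rw [s_simpleRoot, (C.isGCM a).diag i, two_smul]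
  abel

namespace IsRootSystem

variable {R : A → Set (I → ℤ)}

lemma nonneg_or_neg_mem (hR : C.IsRootSystem R) {a : A} {β : I → ℤ} (hβ : β ∈ R a) :
    0 ≤ β ∨ -β ∈ R a ∧ 0 ≤ -β := by
  rw [hR.pos_or_neg a] at hβ
  exact hβ.imp And.right id

lemma image_s' (hR : C.IsRootSystem R) (a : A) (i : I) :
    C.s i (C.ρ i a) '' R (C.ρ i a) = R a := by
  rw [hR.image_s, C.ρ_ρ]

lemma s_mem (hR : C.IsRootSystem R) {a : A} {i : I} {β : I → ℤ} (hβ : β ∈ R (C.ρ i a)) :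
    C.s i (C.ρ i a) β ∈ R a :=
  hR.image_s' a i ▸ Set.mem_image_of_mem _ hβ

/-- The reflection at a simple root `α i` maps the positive roots other than `α i` to positive
roots. -/
lemma s_nonneg (hR : C.IsRootSystem R) {a : A} {i : I} {β : I → ℤ} (hβ : β ∈ R (C.ρ i a))
    (h0 : 0 ≤ β) (hi : β ≠ simpleRoot i) : 0 ≤ C.s i (C.ρ i a) β := by
  -- By (R2) some coordinate off `i` is nonzero, hence positive. The reflection leaves it unchanged,
  -- so (R1) forces the image to be positive.
  obtain ⟨j, hji, hj⟩ : ∃ j, j ≠ i ∧ β j ≠ 0 := by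
    by_contra! h
    have hmul : β = β i • simpleRoot i := by
      ext k
      by_cases hk : k = i
      · subst hk; simp [simpleRoot]
      · simp [simpleRoot, hk, h k hk]
    have hmem : β ∈ R (C.ρ i a) ∩ {β | ∃ n : ℤ, β = n • simpleRoot i} := ⟨hβ, _, hmul⟩
    rw [hR.inter_multiples] at hmem
    rcases hmem with h | h
    · exact hi h
    · have := h0 i
      rw [h] at this
      simp [simpleRoot] at this
  rcases hR.nonneg_or_neg_mem (hR.s_mem hβ) with h | ⟨-, h⟩
  · exact h
  · have h1 := h j
    have h2 := h0 j
    simp only [Pi.neg_apply, Pi.zero_apply, C.s_apply_of_ne _ hji] at h1 h2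
    omega

/-- Every root at `a` is the image under a given word with target `a` of a root at the source
of the word. -/
lemma exists_word_eq (hR : C.IsRootSystem R) (l : List I) (a : A) :
    ∃ b, ∀ β ∈ R a, ∃ γ ∈ R b, C.word a l γ = β := by
  induction l generalizing a with
  | nil => exact ⟨a, fun β hβ => ⟨β, hβ, rfl⟩⟩
  | cons i l ih =>
    obtain ⟨b, hb⟩ := ih (C.ρ i a)
    refine ⟨b, fun β hβ => ?_⟩
    rw [← hR.image_s' a i] at hβ
    obtain ⟨δ, hδ, rfl⟩ := hβ
    obtain ⟨γ, hγ, rfl⟩ := hb δ hδ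
    exact ⟨γ, hγ, rfl⟩

/-- Every functional that does not vanish at a root is positive on the simple system of some
word. -/
lemma exists_word_pos (hR : C.IsRootSystem R) (hsimple : ∀ a j, simpleRoot j ∈ R a)
    (hfin : ∀ a, (R a).Finite) (a : A) (x : (I → ℤ) →+ ℝ) (hx : ∀ β ∈ R a, x β ≠ 0) :
    ∃ l, ∀ j, 0 < x (C.word a l (simpleRoot j)) := by
  induction hn : {β ∈ R a | 0 ≤ β ∧ x β < 0}.ncard using Nat.strong_induction_on
    generalizing a x with
  | _ n ih =>
    by_cases hpos : ∀ j, 0 < x (simpleRoot j)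
    · exact ⟨[], hpos⟩
    push Not at hpos
    obtain ⟨i, hi⟩ := hpos
    have hi : x (simpleRoot i) < 0 := hi.lt_of_ne (hx _ (hsimple a i))
    set x' : (I → ℤ) →+ ℝ := x.comp (C.s i (C.ρ i a)).toLinearMap.toAddMonoidHom with hx'
    have hx'_apply : ∀ β, x' β = x (C.s i (C.ρ i a) β) := fun _ => rfl
    have hlt : {β ∈ R (C.ρ i a) | 0 ≤ β ∧ x' β < 0}.ncard < n := by
      have hfinS : {β ∈ R a | 0 ≤ β ∧ x β < 0}.Finite := (hfin a).subset (Set.sep_subset _ _)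
      -- The reflection embeds the positive roots where `x'` is negative into those where `x` is
      -- negative; `simpleRoot i` is missed, since its preimage is `-simpleRoot i`.
      rw [← hn, ← Set.ncard_image_of_injective _ (C.s i (C.ρ i a)).injective]
      refine Set.ncard_lt_ncard ?_ hfinS
      rw [Set.ssubset_iff_of_subset]
      · refine ⟨simpleRoot i, ⟨hsimple a i, simpleRoot_nonneg i, hi⟩, ?_⟩
        rintro ⟨β, ⟨-, h0, -⟩, hβ⟩
        have hβ' : β = -simpleRoot i := by
          apply (C.s i (C.ρ i a)).injective
          rw [hβ, map_neg, s_simpleRoot_self, neg_neg]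
        have := h0 i
        rw [hβ'] at this
        simp [simpleRoot] at this
      · rintro _ ⟨β, ⟨hβ, h0, hneg⟩, rfl⟩
        refine ⟨hR.s_mem hβ, hR.s_nonneg hβ h0 ?_, hneg⟩
        rintro rfl
        rw [hx'_apply, s_simpleRoot_self, map_neg] at hneg
        linarith
    obtain ⟨l, hl⟩ := ih _ hlt (C.ρ i a) x' (fun β hβ => hx _ (hR.s_mem hβ)) rfl
    exact ⟨i :: l, hl⟩

/-- A functional that is positive on the simple system of some word does not vanish at a root. -/
lemma ne_zero_of_word_pos (hR : C.IsRootSystem R) (h0 : ∀ a, 0 ∉ R a) {a : A} {l : List I}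
    {x : (I → ℤ) →+ ℝ} (hx : ∀ j, 0 < x (C.word a l (simpleRoot j))) {β : I → ℤ}
    (hβ : β ∈ R a) : x β ≠ 0 := by
  obtain ⟨b, hb⟩ := hR.exists_word_eq l a
  obtain ⟨γ, hγ, rfl⟩ := hb β hβ
  have key : ∀ γ : I → ℤ, 0 ≤ γ → γ ≠ 0 → 0 < x (C.word a l γ) := by
    intro γ hγ hne
    obtain ⟨k, hk⟩ := Function.ne_iff.mp hne
    rw [← sum_smul_simpleRoot γ, map_sum, map_sum]
    simp only [map_zsmul]
    exact Finset.sum_pos' (fun j _ => zsmul_nonneg (hx j).le (hγ j))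
      ⟨k, Finset.mem_univ k, zsmul_pos (hx k) ((hγ k).lt_of_ne' hk)⟩
  have hne : γ ≠ 0 := fun h => h0 b (h ▸ hγ)
  rcases hR.nonneg_or_neg_mem hγ with h | ⟨-, h⟩
  · exact (key γ h hne).ne'
  · have := key (-γ) h (neg_ne_zero.mpr hne)
    rw [map_neg, map_neg] at this
    linarith

end IsRootSystem

end CartanScheme

/-- The entrywise inclusion of `ℤ^I` into `ℝ^I`. -/
def intCastPi (I : Type*) : (I → ℤ) →+ (I → ℝ) :=
  (Int.castAddHom ℝ).compLeft I

lemma intCastPi_apply {I : Type*} (β : I → ℤ) : intCastPi I β = fun i => (β i : ℝ) := rfl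

lemma intCastPi_injective (I : Type*) : Function.Injective (intCastPi I) := fun β γ h => by
  ext i
  exact Int.cast_injective (α := ℝ) (congrFun h i)

/-- The images of the simple roots under an automorphism of `ℤ^I` form a basis of `ℝ^I`. -/
lemma exists_basis_intCastPi {I : Type*} [Fintype I] [DecidableEq I]
    (w : (I → ℤ) ≃ₗ[ℤ] (I → ℤ)) :
    ∃ u : Module.Basis I ℝ (I → ℝ), ∀ j, u j = intCastPi I (w (simpleRoot j)) := by
  have hmem : ∀ γ, intCastPi I (w γ) ∈
      Submodule.span ℝ (Set.range fun j => intCastPi I (w (simpleRoot j))) := by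
    intro γ
    rw [← sum_smul_simpleRoot γ, map_sum, map_sum]
    refine Submodule.sum_mem _ fun j _ => ?_
    rw [map_zsmul, map_zsmul]
    exact zsmul_mem (Submodule.subset_span (Set.mem_range_self j)) _
  have htop : ⊤ ≤ Submodule.span ℝ (Set.range fun j => intCastPi I (w (simpleRoot j))) := by
    rw [← (Pi.basisFun ℝ I).span_eq, Submodule.span_le]
    rintro _ ⟨k, rfl⟩
    -- Surjectivity of `w` over `ℤ` already puts the standard basis in the span.
    have : Pi.basisFun ℝ I k = intCastPi I (w (w.symm (simpleRoot k))) := by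
      ext i
      simp [intCastPi_apply, simpleRoot, Pi.single_apply]
    rw [this]
    exact hmem _
  exact ⟨basisOfTopLeSpanOfCardEqFinrank _ htop (by simp), fun j => by simp⟩

lemma IsScalarProduct.nondegenerate {V : Type*} [AddCommGroup V] [Module ℝ V]
    {B : LinearMap.BilinForm ℝ V} (hB : IsScalarProduct B) : B.Nondegenerate := by
  constructor
  · intro x hx
    by_contra h
    exact (hB.pos x h).ne' (hx x)
  · intro x hx
    by_contra h
    exact (hB.pos x h).ne' (hx x)

/-- The vectors having positive product with all elements of a basis form an open simplicial
cone. -/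
lemma isOpenSimplicialCone_of_basis {ι V : Type*} [Fintype ι] [DecidableEq ι] [AddCommGroup V]
    [Module ℝ V] {B : LinearMap.BilinForm ℝ V} (hB : B.Nondegenerate) (u : Module.Basis ι ℝ V) :
    IsOpenSimplicialCone {v | ∀ j, 0 < B v (u j)} := by
  have : FiniteDimensional ℝ V := u.finiteDimensional_of_finite
  let e : ι ≃ Fin (Module.finrank ℝ V) :=
    Fintype.equivFinOfCardEq (Module.finrank_eq_card_basis u).symm
  -- The coordinate of `v` along `d j` is `B v (u j)`, so the inequalities say that all coordinates
  -- are positive.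
  let d := B.dualBasis hB u
  have hd : ∀ i j, B (d i) (u j) = if j = i then 1 else 0 := B.apply_dualBasis_left hB u
  refine ⟨d.reindex e, Set.ext fun v => ⟨fun hv => ?_, ?_⟩⟩
  · refine ⟨fun k => B v (u (e.symm k)), fun k => hv _, ?_⟩
    rw [← e.sum_comp]
    simp only [Module.Basis.reindex_apply, Equiv.symm_apply_apply]
    conv_lhs => rw [← d.sum_repr v]
    refine Finset.sum_congr rfl fun j _ => ?_
    rw [B.dualBasis_repr_apply hB u]
  · rintro ⟨c, hc, rfl⟩ j
    rw [← e.sum_comp]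
    simpa [hd] using hc (e j)

/-- A nonvanishing linear form on a preconnected set that is positive at one point is positive. -/
lemma IsPreconnected.pos_of_ne_zero {X : Type*} [TopologicalSpace X] {S : Set X}
    (hS : IsPreconnected S) {f : X → ℝ} (hf : ContinuousOn f S) (h0 : ∀ y ∈ S, f y ≠ 0) {x y : X}
    (hx : x ∈ S) (hy : y ∈ S) (hpos : 0 < f x) : 0 < f y := by
  by_contra! h
  obtain ⟨z, hz, hz0⟩ := hS.intermediate_value hy hx hf ⟨h, hpos.le⟩
  exact h0 z hz hz0

theorem mainTheorem5 {I A : Type*} [Fintype I] [DecidableEq I] [Finite A]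
    (C : CartanScheme I A)
    (hroot : C.IsRootSystem C.realRoots)
    (hfin : ∀ b : A, (C.realRoots b).Finite)
    (a : A) (B : LinearMap.BilinForm ℝ (I → ℝ)) (hB : IsScalarProduct B) :
    IsSimplicialArrangement (C.arrangement a B) := by
  have hcompl : ∀ v, v ∈ (⋃ H ∈ C.arrangement a B, (H : Set (I → ℝ)))ᶜ ↔
      ∀ β ∈ C.realRoots a, B v (intCastPi I β) ≠ 0 := by
    intro v
    simp only [Set.mem_compl_iff, Set.mem_iUnion, not_exists, SetLike.mem_coe]
    constructor
    · intro h β hβ hv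
      rcases hroot.nonneg_or_neg_mem hβ with h0 | ⟨hβ', h0⟩
      · exact h _ ⟨β, hβ, h0, rfl⟩ hv
      · refine h _ ⟨-β, hβ', h0, rfl⟩ ?_
        change B v (intCastPi I (-β)) = 0
        rw [map_neg, map_neg, hv, neg_zero]
    · rintro h _ ⟨β, hβ, -, rfl⟩ hv
      exact h β hβ hv
  refine ⟨?_, ?_, fun x hx => ?_⟩
  · refine ((hfin a).image (CartanScheme.rootHyperplane B)).subset ?_
    rintro _ ⟨β, hβ, -, rfl⟩
    exact ⟨β, hβ, rfl⟩
  · rintro _ ⟨β, hβ, -, rfl⟩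
    have hne : intCastPi I β ≠ 0 := by
      rw [Ne, map_eq_zero_iff _ (intCastPi_injective I)]
      exact CartanScheme.ne_zero_of_mem_realRoots hβ
    refine LinearMap.isCoatom_ker_of_surjective (LinearMap.surjective fun h => ?_)
    exact (hB.pos _ hne).ne' (LinearMap.congr_fun h (intCastPi I β))
  · let φ : (I → ℝ) → ((I → ℤ) →+ ℝ) := fun v => (B v).toAddMonoidHom.comp (intCastPi I)
    obtain ⟨l, hl⟩ := hroot.exists_word_pos (fun a j => C.simpleRoot_mem_realRoots a j) hfin a
      (φ x) ((hcompl x).1 hx)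
    obtain ⟨u, hu⟩ := exists_basis_intCastPi (C.word a l)
    convert isOpenSimplicialCone_of_basis hB.nondegenerate u using 1
    simp only [hu]
    apply subset_antisymm
    · intro y hy j
      -- Each `w(α_j)` is itself a root, so its form has no zero on the component and keeps the sign
      -- it has at `x`.
      refine isPreconnected_connectedComponentIn.pos_of_ne_zero
        (f := B.flip (intCastPi I (C.word a l (simpleRoot j))))
        (LinearMap.continuous_of_finiteDimensional _).continuousOn (fun z hz => ?_)
        (mem_connectedComponentIn hx) hy (hl j)
      exact (hcompl z).1 (connectedComponentIn_subset _ _ hz) _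
        (C.word_simpleRoot_mem_realRoots a l j)
    -- The cone contains `x`, avoids every hyperplane, and is connected because it is an
    -- intersection of half-spaces.
    · refine IsPreconnected.subset_connectedComponentIn ?_ hl fun v hv => (hcompl v).2 fun β hβ =>
        hroot.ne_zero_of_word_pos (x := φ v)
          (fun b hb => CartanScheme.ne_zero_of_mem_realRoots hb rfl) hv hβ
      rw [Set.ofPred_forall]
      exact (convex_iInter fun j =>
        convex_halfSpace_gt (B.flip (intCastPi I (C.word a l (simpleRoot j)))).isLinear
          0).isPreconnected
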